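/- Let $d$ be a positive integer and let $\mathcal D$ be the set of $d\times d$ density matrices, that is, complex positive semidefinite matrices $\rho$ with $\operatorname{Tr}\rho=1$. For $\rho\in\mathcal D$ let $\lambda(\rho)=(\lambda_1,\dots,\lambda_d)$ be the vector of its eigenvalues, with multiplicity, in non-increasing order. Let $\mathcal F$ be the class of functions $f:\mathcal D\to\mathbb R$ that are concave on $\mathcal D$ and for which there is a permutation-invariant function $\varphi:\mathbb R^d\to\mathbb R$ with $f(\rho)=\varphi(\lambda(\rho))$ for all $\rho\in\mathcal D$. For $a\in[0,1]$ and $\rho,\sigma\in\mathcal D$ put $$\rho\boxplus_a\sigma := a\rho+(1-a)\sigma-\sqrt{a(1-a)}\;i\,(\rho\sigma-\sigma\rho).$$ Then for all $\rho,\sigma\in\mathcal D$, $a\in[0,1]$ and $f\in\mathcal F$, the matrix $\rho\boxplus_a\sigma$ is again in $\mathcal D$ and $$f(\rho\boxplus_a\sigma)\;\ge\; a\,f(\rho)+(1-a)\,f(\sigma).$$ Moreover, the following functions belong to $\mathcal F$, so the inequality holds for each of them: 1. the von Neumann entropy $H(\rho)=-\sum_{i}\lambda_i\log\lambda_i$ (with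 $0\log 0=0$); 2. for every $\alpha\in[0,1)$, the Rényi entropy $H_\alpha(\rho)=\frac{1}{1-\alpha}\log\sum_{i:\lambda_i\neq0}\lambda_i^\alpha$ (so $H_0(\rho)=\log\operatorname{rank}\rho$); 3. the subentropy $$Q(\rho)=\lim_{\mu\to\lambda(\rho)}\Bigl(-\sum_{i=1}^d\frac{\mu_i^d}{\prod_{j\ne i}(\mu_i-\mu_j)}\log\mu_i\Bigr),$$ the limit being over vectors $\mu\in\mathbb R^d$ with pairwise distinct positive entries; this limit exists and is finite for every $\rho\in\mathcal D$. -/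

import Mathlib

open scoped Topology ComplexOrder

namespace QuditEPI

/-- The set `𝒟(ℂ^d)` of density matrices: positive semidefinite matrices of trace one. -/
def densityMatrices (d : ℕ) : Set (Matrix (Fin d) (Fin d) ℂ) :=
  {ρ | ρ.PosSemidef ∧ ρ.trace = 1}

open Classical in
/-- The vector of eigenvalues of a Hermitian matrix, with multiplicity and in non-increasing order.
(The value `0` at non-Hermitian matrices is never used.) -/
noncomputable def spectrumVec {d : ℕ} (A : Matrix (Fin d) (Fin d) ℂ) : Fin d → ℝ :=
  if hA : A.IsHermitian then
    fun i => hA.eigenvalues₀ (Fin.cast (Fintype.card_fin d).symm i)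
  else 0

/-- The partial swap addition rule `a ρ + (1 - a) σ - √(a (1 - a)) i [ρ, σ]`. -/
noncomputable def boxplus {d : ℕ} (a : ℝ) (ρ σ : Matrix (Fin d) (Fin d) ℂ) :
    Matrix (Fin d) (Fin d) ℂ :=
  a • ρ + (1 - a) • σ - ((Real.sqrt (a * (1 - a)) : ℂ) * Complex.I) • (ρ * σ - σ * ρ)

/-- The class of functions on density matrices that are concave and are given by a
permutation-invariant function of the eigenvalues. Only the values of `f` on density matrices
are constrained. -/
def classF (d : ℕ) : Set (Matrix (Fin d) (Fin d) ℂ → ℝ) :=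
  {f | ConcaveOn ℝ (densityMatrices d) f ∧
    ∃ φ : (Fin d → ℝ) → ℝ,
      (∀ (π : Equiv.Perm (Fin d)) (v : Fin d → ℝ), φ (v ∘ π) = φ v) ∧
      ∀ ρ ∈ densityMatrices d, f ρ = φ (spectrumVec ρ)}

/-- The von Neumann entropy `- ∑ᵢ λᵢ log λᵢ`, with `0 log 0 = 0`. -/
noncomputable def vonNeumannEntropy {d : ℕ} (ρ : Matrix (Fin d) (Fin d) ℂ) : ℝ :=
  - ∑ i, spectrumVec ρ i * Real.log (spectrumVec ρ i)

/-- The Rényi entropy `(1 - α)⁻¹ log Tr ρ^α`. The power is taken on the support of `ρ`, which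
matters only for `α = 0`, where the entropy is the logarithm of the rank. -/
noncomputable def renyiEntropy {d : ℕ} (α : ℝ) (ρ : Matrix (Fin d) (Fin d) ℂ) : ℝ :=
  1 / (1 - α) * Real.log (∑ i with spectrumVec ρ i ≠ 0, spectrumVec ρ i ^ α)

/-- The subentropy expression in terms of distinct positive eigenvalues. -/
noncomputable def subentropyExpr {d : ℕ} (μ : Fin d → ℝ) : ℝ :=
  - ∑ i, μ i ^ d / (∏ j ∈ Finset.univ.erase i, (μ i - μ j)) * Real.log (μ i)

/-- Vectors with distinct positive entries tending to the eigenvalue vector of `ρ`. -/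
noncomputable def genericNhds {d : ℕ} (ρ : Matrix (Fin d) (Fin d) ℂ) : Filter (Fin d → ℝ) :=
  𝓝[{μ | Function.Injective μ ∧ ∀ i, 0 < μ i}] (spectrumVec ρ)

/-- The subentropy, as the limit of the above expression when distinct positive numbers tend to
the eigenvalues of `ρ`. -/
noncomputable def subentropy {d : ℕ} (ρ : Matrix (Fin d) (Fin d) ℂ) : ℝ :=
  Filter.limUnder (genericNhds ρ) subentropyExpr

end QuditEPI

/-! The heart of the matter is a majorization: the spectrum of `ρ ⊞ σ` is majorized by `a λ(ρ) + (1
- a) λ(σ)`, both spectra sorted (`sum_spectrumVec_swapSum_le`). A symmetric concave `φ` is Schur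
concave on the simplex (`le_of_majorized`), so `φ` at the spectrum of the sum is at least `φ` at
that mixture, and concavity finishes.

For the majorization, work in an eigenbasis of the sum and add its eigenvalues over an index set
`A`. The commutator terms inside `A × A` cancel by antisymmetry. Those in `A × Aᶜ` are absorbed by
AM-GM into `a |ρ_ij|² + (1 - a) |σ_ij|²` (`commutator_im_le`), and the coefficient `√(a (1 - a))` is
just small enough for this. It remains to bound, for a single state, the diagonal over `A` plus the
squared norm of the off-diagonal block by the sum of the `|A|` largest eigenvalues
(`sum_diag_add_offDiag_le`). This sharpens Ky Fan's principle and rests on the rearrangement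
estimate `sum_mul_add_sq_sub_le`.

With commutator coefficient zero the same argument shows that symmetric concave functions of the
spectrum are concave in the matrix, which reduces membership in the class to concavity on the
simplex. For the subentropy this is visible from an integral representation whose integrand is
concave at each `t` and makes sense for repeated or vanishing eigenvalues. -/

namespace QuditEPI

/-! ### Majorization and concave symmetric functions -/

/-- A weighted sum with weights in `[0, 1]` of total weight `K` is at most the sum of the `K`
largest terms. -/
theorem sum_mul_le_sum_largest {d K : ℕ} {l w : Fin d → ℝ} (hl : Antitone l)
    (h0 : ∀ k, 0 ≤ w k) (h1 : ∀ k, w k ≤ 1) (hK : ∑ k, w k = K) :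
    ∑ k, l k * w k ≤ ∑ k with k.val < K, l k := by
  have hKd : K ≤ d := by
    have : (K : ℝ) ≤ d := by
      rw [← hK]
      simpa using Finset.sum_le_sum (fun k (_ : k ∈ Finset.univ) => h1 k)
    exact_mod_cast this
  rcases Nat.eq_zero_or_pos K with rfl | hpos
  · have hw : ∀ k, w k = 0 := by
      have := (Finset.sum_eq_zero_iff_of_nonneg (fun k _ => h0 k)).1 (by simpa using hK)
      simpa using this
    simp [hw]
  -- `m` is the last of the `K` largest positions. With threshold `l m` one has `(l k - l m) * (w k
  -- - 1_{k < K}) ≤ 0` termwise, and the threshold terms cancel in the sum because both weights have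
  -- total `K`.
  set m : Fin d := ⟨K - 1, by omega⟩ with hm
  have key : ∀ k : Fin d,
      l k * w k ≤ (if k.val < K then l k else 0) + l m * (w k - if k.val < K then 1 else 0) := by
    intro k
    split_ifs with h
    · have : l m ≤ l k := hl (Fin.le_def.2 (by simp [hm]; omega))
      nlinarith [h1 k]
    · have : l k ≤ l m := hl (Fin.le_def.2 (by simp [hm]; omega))
      nlinarith [h0 k]
  refine (Finset.sum_le_sum fun k _ => key k).trans ?_
  rw [Finset.sum_add_distrib, ← Finset.mul_sum, Finset.sum_sub_distrib, hK,
    ← Finset.sum_filter, ← Finset.sum_filter]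
  have : ((Finset.univ.filter fun k : Fin d => k.val < K).card : ℝ) = K := by
    rw [Fin.card_filter_val_lt, min_eq_right hKd]
  simp [this]

/-- Abel summation: if the partial sums of `z` are nonnegative and `c` is antitone, then
`∑ c z` is bounded below. -/
theorem mul_sum_range_le_sum_mul {c z : ℕ → ℝ} (n : ℕ)
    (hc : ∀ i, i + 1 ≤ n → c (i + 1) ≤ c i)
    (hz : ∀ m, m ≤ n + 1 → 0 ≤ ∑ i ∈ Finset.range m, z i) :
    c n * ∑ i ∈ Finset.range (n + 1), z i ≤ ∑ i ∈ Finset.range (n + 1), c i * z i := by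
  induction n with
  | zero => simp
  | succ n ih =>
    have h := ih (fun i hi => hc i (by omega)) (fun m hm => hz m (by omega))
    rw [Finset.sum_range_succ _ (n + 1), Finset.sum_range_succ _ (n + 1), mul_add]
    have h1 := hc n le_rfl
    have h2 := hz (n + 1) (by omega)
    nlinarith [mul_le_mul_of_nonneg_right h1 h2]

/-- Abel summation against an antitone weight vector. -/
theorem sum_mul_nonneg_of_antitone {d : ℕ} {c z : Fin d → ℝ} (hc : Antitone c)
    (hz : ∀ m, m ≤ d → 0 ≤ ∑ k with k.val < m, z k) (h0 : ∑ k, z k = 0) :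
    0 ≤ ∑ k, c k * z k := by
  rcases d with _ | n
  · simp
  let c' : ℕ → ℝ := fun i => if h : i < n + 1 then c ⟨i, h⟩ else 0
  let z' : ℕ → ℝ := fun i => if h : i < n + 1 then z ⟨i, h⟩ else 0
  have hzz : ∀ m, m ≤ n + 1 →
      ∑ i ∈ Finset.range m, z' i = ∑ k : Fin (n + 1) with k.val < m, z k := by
    intro m hm
    rw [Finset.sum_filter, Finset.sum_fin_eq_sum_range, ← Finset.sum_subset
      (Finset.range_mono hm)]
    · refine Finset.sum_congr rfl fun i hi => ?_
      have := Finset.mem_range.1 hi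
      simp [z', this]
    · intro i hi hi'
      simp only [Finset.mem_range] at hi hi'
      simp [hi']
  have := mul_sum_range_le_sum_mul (c := c') (z := z') n (fun i hi => by
      have h1 : i + 1 < n + 1 := by omega
      have h2 : i < n + 1 := by omega
      simp only [c', dif_pos h1, dif_pos h2]
      exact hc (Fin.le_def.2 (by simp))) (fun m hm => by rw [hzz m hm]; exact hz m hm)
  rw [hzz _ le_rfl] at this
  have e : ∑ k : Fin (n + 1) with k.val < n + 1, z k = 0 := by
    rw [← h0]; congr 1; ext k; simp; omega
  rw [e, mul_zero] at this
  refine this.trans_eq ?_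
  rw [Finset.sum_fin_eq_sum_range]
  refine Finset.sum_congr rfl fun i hi => ?_
  have := Finset.mem_range.1 hi
  simp only [z', c', dif_pos this]

/-- A vector majorized by `y` lies in the convex hull of the permutations of `y`. -/
theorem mem_convexHull_perm_of_majorized {d : ℕ} {x y : Fin d → ℝ}
    (h : ∀ A : Finset (Fin d), ∑ i ∈ A, x i ≤ ∑ k with k.val < A.card, y k)
    (hs : ∑ i, x i = ∑ i, y i) :
    x ∈ convexHull ℝ (Set.range fun π : Equiv.Perm (Fin d) => y ∘ π) := by
  by_contra hx
  -- A separating functional `c` would give `x` a larger value than every permutation of `y`. The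
  -- permutation that places `y` in the decreasing order of `c` contradicts this, by Abel summation
  -- of the partial-sum hypotheses.
  obtain ⟨f, u, hu, hfx⟩ := geometric_hahn_banach_closed_point (convex_convexHull ℝ _)
    ((Set.finite_range fun π : Equiv.Perm (Fin d) => y ∘ π).isCompact_convexHull
      (𝕜 := ℝ)).isClosed hx
  set c : Fin d → ℝ := fun i => f (Pi.single i 1) with hcdef
  have hf : ∀ v : Fin d → ℝ, f v = ∑ i, c i * v i := by
    intro v
    conv_lhs => rw [← Finset.univ_sum_single v, map_sum]
    refine Finset.sum_congr rfl fun i _ => ?_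
    have : (Pi.single i (v i) : Fin d → ℝ) = v i • Pi.single i 1 := by
      rw [← Pi.single_smul]; simp
    rw [this, map_smul, smul_eq_mul, mul_comm]
  set s := Tuple.sort (-c) with hsdef
  have hanti : Antitone (c ∘ s) := by
    intro i j hij
    have := Tuple.monotone_sort (-c) hij
    simpa using this
  have hy := hu (y ∘ s.symm) (subset_convexHull ℝ _ ⟨s.symm, rfl⟩)
  have e1 : f (y ∘ s.symm) = ∑ k, c (s k) * y k := by
    rw [hf, ← Equiv.sum_comp s]
    simp
  have e2 : f x = ∑ k, c (s k) * x (s k) := by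
    rw [hf, ← Equiv.sum_comp s]
  have := sum_mul_nonneg_of_antitone (z := fun k => y k - x (s k)) hanti (fun m hm => by
    rw [Finset.sum_sub_distrib, sub_nonneg]
    have := h ((Finset.univ.filter fun k : Fin d => k.val < m).map s.toEmbedding)
    rwa [Finset.sum_map, Finset.card_map, Fin.card_filter_val_lt, min_eq_right hm] at this) (by
    rw [Finset.sum_sub_distrib, Equiv.sum_comp s x, hs, sub_self])
  simp only [mul_sub, Finset.sum_sub_distrib, Function.comp_apply] at this
  rw [e1] at hy
  rw [e2] at hfx
  linarith

/-- Schur concavity of symmetric concave functions on the standard simplex. -/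
theorem le_of_majorized {d : ℕ} {φ : (Fin d → ℝ) → ℝ}
    (hφ : ConcaveOn ℝ (stdSimplex ℝ (Fin d)) φ)
    (hsymm : ∀ (π : Equiv.Perm (Fin d)) (v : Fin d → ℝ), φ (v ∘ π) = φ v)
    {x y : Fin d → ℝ} (hy : y ∈ stdSimplex ℝ (Fin d))
    (h : ∀ A : Finset (Fin d), ∑ i ∈ A, x i ≤ ∑ k with k.val < A.card, y k)
    (hs : ∑ i, x i = ∑ i, y i) : φ y ≤ φ x := by
  obtain ⟨_, ⟨π, rfl⟩, hπ⟩ := hφ.exists_le_of_mem_convexHull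
    (t := Set.range fun π : Equiv.Perm (Fin d) => y ∘ π) (by
      rintro _ ⟨π, rfl⟩
      exact ⟨fun i => hy.1 _, by simpa using (Equiv.sum_comp π y).trans hy.2⟩)
    (mem_convexHull_perm_of_majorized h hs)
  simpa [hsymm] using hπ

/-! ### A rearrangement estimate for a symmetric array -/

/-- The estimate behind the majorization relation: `p k l` stands for the squared moduli of the
entries of an orthogonal projection with diagonal `q`. -/
theorem sum_mul_add_sq_sub_le {d K : ℕ} {l q : Fin d → ℝ} {p : Fin d → Fin d → ℝ}
    (hl : Antitone l) (l0 : ∀ k, 0 ≤ l k) (l1 : ∀ k, l k ≤ 1)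
    (p0 : ∀ k m, 0 ≤ p k m) (psymm : ∀ k m, p k m = p m k)
    (prow : ∀ k, ∑ m, p k m = q k) (pdiag : ∀ k, p k k = q k ^ 2)
    (hK : ∑ k, q k = K) :
    ∑ k, l k * q k + (∑ k, l k ^ 2 * q k - ∑ k, ∑ m, l k * l m * p k m) ≤
      ∑ k with k.val < K, l k := by
  let s : Fin d → Fin d → ℝ := fun k m => if k < m then 1 else if m < k then -1 else 0
  have santi : ∀ k m, s k m = - s m k := by
    intro k m
    rcases lt_trichotomy k m with h | h | h
    · simp [s, h, h.not_gt]
    · simp [s, h]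
    · simp [s, h, h.not_gt]
  have s1 : ∀ k m, s k m ≤ 1 := fun k m => by simp only [s]; split_ifs <;> norm_num
  have s2 : ∀ k m, -1 ≤ s k m := fun k m => by simp only [s]; split_ifs <;> norm_num
  -- The quadratic gain equals `½ ∑ (l k - l m)² p k m`, at most `½ ∑ |l k - l m| p k m` since `l`
  -- lies in `[0, 1]`. The latter is linear in `l`, because the sign of `l k - l m` is governed by
  -- `s`. So the left side is at most `∑ l k * w k`, and it suffices that `w` is an admissible
  -- weight.
  let w : Fin d → ℝ := fun k => q k + ∑ m, s k m * p k m
  have w0 : ∀ k, 0 ≤ w k := by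
    intro k
    simp only [w, ← prow k, ← Finset.sum_add_distrib]
    refine Finset.sum_nonneg fun m _ => ?_
    nlinarith [p0 k m, s2 k m]
  have w1 : ∀ k, w k ≤ 1 := by
    intro k
    -- The diagonal term drops out because `s k k = 0`, which saves `q k ^ 2`; hence `w k ≤ 1 - (1 -
    -- q k) ^ 2`.
    have : ∑ m, s k m * p k m ≤ q k - q k ^ 2 := by
      have hk := prow k
      rw [← Finset.add_sum_erase _ _ (Finset.mem_univ k)] at hk ⊢
      have : s k k = 0 := by simp [s]
      rw [this, zero_mul, zero_add, ← pdiag k, ← hk, add_sub_cancel_left]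
      refine Finset.sum_le_sum fun m _ => ?_
      nlinarith [p0 k m, s1 k m]
    simp only [w]
    nlinarith [sq_nonneg (q k - 1)]
  have hanti : ∀ g : Fin d → Fin d → ℝ, (∀ k m, g k m = - g m k) → ∑ k, ∑ m, g k m = 0 := by
    intro g hg
    have : ∑ k, ∑ m, g k m = - ∑ k, ∑ m, g k m := by
      conv_lhs => rw [Finset.sum_comm]
      simp_rw [← Finset.sum_neg_distrib]
      exact Finset.sum_congr rfl fun k _ => Finset.sum_congr rfl fun m _ => hg m k
    linarith
  have wK : ∑ k, w k = K := by
    simp only [w, Finset.sum_add_distrib, hK]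
    rw [hanti _ fun k m => by rw [santi k m, psymm k m]; ring, add_zero]
  refine le_trans ?_ (sum_mul_le_sum_largest hl w0 w1 wK)
  have e1 : ∑ k, l k ^ 2 * q k - ∑ k, ∑ m, l k * l m * p k m =
      ∑ k, ∑ m, (l k - l m) ^ 2 / 2 * p k m := by
    have : ∑ k, l k ^ 2 * q k = ∑ k, ∑ m, l k ^ 2 * p k m := by
      simp_rw [← prow, Finset.mul_sum]
    rw [this, ← sub_eq_zero]
    simp_rw [← Finset.sum_sub_distrib]
    exact hanti _ fun k m => by rw [psymm k m]; ring
  have e2 : ∑ k, l k * ∑ m, s k m * p k m = ∑ k, ∑ m, (l k - l m) / 2 * s k m * p k m := by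
    simp_rw [Finset.mul_sum]
    rw [← sub_eq_zero]
    simp_rw [← Finset.sum_sub_distrib]
    exact hanti _ fun k m => by rw [psymm k m, santi k m]; ring
  simp only [w, mul_add, Finset.sum_add_distrib, e1, e2]
  gcongr with k _ m _
  · exact p0 k m
  · rcases lt_trichotomy k m with h | h | h
    · have := hl h.le
      simp only [s, h, if_true]
      nlinarith [l0 k, l0 m, l1 k, l1 m]
    · simp [h]
    · have := hl h.le
      simp only [s, h, h.not_gt, if_true, if_false]
      nlinarith [l0 k, l0 m, l1 k, l1 m]

open Matrix

/-! ### The ordered spectrum -/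

theorem exists_spectrumVec_eq_comp {d : ℕ} {A : Matrix (Fin d) (Fin d) ℂ} (hA : A.IsHermitian) :
    ∃ e : Equiv.Perm (Fin d), spectrumVec A = hA.eigenvalues ∘ e := by
  refine ⟨(finCongr (Fintype.card_fin d).symm).trans
    (Fintype.equivOfCardEq (Fintype.card_fin _)), ?_⟩
  ext i
  simp [spectrumVec, hA, IsHermitian.eigenvalues]

theorem spectrumVec_antitone {d : ℕ} (A : Matrix (Fin d) (Fin d) ℂ) :
    Antitone (spectrumVec A) := by
  unfold spectrumVec
  split_ifs with hA
  · exact fun i j hij => hA.eigenvalues₀_antitone (by simpa using hij)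
  · exact fun i j _ => le_rfl

theorem exists_spectral_decomposition {d : ℕ} {A : Matrix (Fin d) (Fin d) ℂ}
    (hA : A.IsHermitian) : ∃ U : Matrix (Fin d) (Fin d) ℂ, U * Uᴴ = 1 ∧
      A = U * diagonal (fun k => (spectrumVec A k : ℂ)) * Uᴴ := by
  obtain ⟨e, he⟩ := exists_spectrumVec_eq_comp hA
  have hV : (hA.eigenvectorUnitary : Matrix (Fin d) (Fin d) ℂ) *
      (hA.eigenvectorUnitary : Matrix (Fin d) (Fin d) ℂ)ᴴ = 1 :=
    Unitary.coe_mul_star_self hA.eigenvectorUnitary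
  refine ⟨(hA.eigenvectorUnitary : Matrix (Fin d) (Fin d) ℂ).submatrix id e, ?_, ?_⟩
  · rw [conjTranspose_submatrix, submatrix_mul_equiv, hV]
    simp
  · have h := hA.spectral_theorem
    rw [Unitary.conjStarAlgAut_apply] at h
    have hD : diagonal (fun k => (spectrumVec A k : ℂ)) =
        (diagonal ((RCLike.ofReal : ℝ → ℂ) ∘ hA.eigenvalues)).submatrix e e := by
      rw [submatrix_diagonal_equiv, he]
      rfl
    rw [hD, conjTranspose_submatrix, submatrix_mul_equiv, submatrix_mul_equiv]
    rw [submatrix_id_id]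
    exact h

theorem sum_spectrumVec {d : ℕ} {A : Matrix (Fin d) (Fin d) ℂ} (hA : A.IsHermitian) :
    ((∑ i, spectrumVec A i : ℝ) : ℂ) = A.trace := by
  obtain ⟨e, he⟩ := exists_spectrumVec_eq_comp hA
  rw [hA.trace_eq_sum_eigenvalues, he]
  simp only [Function.comp_apply, Equiv.sum_comp e hA.eigenvalues]
  push_cast
  rfl

theorem spectrumVec_mem_stdSimplex {d : ℕ} {ρ : Matrix (Fin d) (Fin d) ℂ}
    (hρ : ρ ∈ densityMatrices d) : spectrumVec ρ ∈ stdSimplex ℝ (Fin d) := by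
  obtain ⟨e, he⟩ := exists_spectrumVec_eq_comp hρ.1.isHermitian
  refine ⟨fun i => ?_, ?_⟩
  · rw [he]
    exact hρ.1.eigenvalues_nonneg _
  · have h := (sum_spectrumVec hρ.1.isHermitian).trans hρ.2
    exact_mod_cast h

/-- Two tuples with the same multiset of values differ by a permutation. -/
theorem exists_perm_of_map_univ_eq {d : ℕ} {f g : Fin d → ℝ}
    (h : Finset.univ.val.map f = Finset.univ.val.map g) :
    ∃ π : Equiv.Perm (Fin d), f = g ∘ π := by
  have hp : (List.ofFn f).Perm (List.ofFn g) := by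
    rw [← Multiset.coe_eq_coe, ← Fin.univ_val_map, ← Fin.univ_val_map, h]
  have hs : f ∘ Tuple.sort f = g ∘ Tuple.sort g :=
    List.ofFn_injective <| List.Perm.eq_of_sortedLE
      (Tuple.monotone_sort f).sortedLE_ofFn (Tuple.monotone_sort g).sortedLE_ofFn
      (((Equiv.Perm.ofFn_comp_perm _ f).trans hp).trans (Equiv.Perm.ofFn_comp_perm _ g).symm)
  refine ⟨(Tuple.sort f).symm.trans (Tuple.sort g), ?_⟩
  ext i
  simpa using congrFun hs ((Tuple.sort f).symm i)

/-- The spectrum of a real diagonal matrix is a rearrangement of its diagonal. -/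
theorem exists_spectrumVec_diagonal {d : ℕ} (v : Fin d → ℝ) :
    ∃ π : Equiv.Perm (Fin d), spectrumVec (diagonal fun k => (v k : ℂ)) = v ∘ π := by
  have hA : (diagonal fun k => (v k : ℂ)).IsHermitian := by
    rw [isHermitian_diagonal_iff]
    intro i
    simp [IsSelfAdjoint]
  obtain ⟨e, he⟩ := exists_spectrumVec_eq_comp hA
  have h := hA.roots_charpoly_eq_eigenvalues
  rw [charpoly_diagonal, Polynomial.roots_prod _ _ (by
    simp [Finset.prod_ne_zero_iff, Polynomial.X_sub_C_ne_zero])] at h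
  -- Both multisets of roots of the characteristic polynomial consist of real numbers, so real parts
  -- lose nothing.
  have h' := congrArg (Multiset.map Complex.re) h
  simp only [Polynomial.roots_X_sub_C, Multiset.bind_singleton, Multiset.map_map] at h'
  obtain ⟨π, hπ⟩ := exists_perm_of_map_univ_eq (f := hA.eigenvalues) (g := v) h'.symm
  exact ⟨e.trans π, by rw [he, hπ]; rfl⟩

/-! ### Partial traces of a Hermitian matrix in another orthonormal basis -/

/-- The diagonal sum over `A` plus the squared norm of the off-diagonal block `A × Aᶜ` of a matrix
with spectrum in `[0, 1]` is at most the sum of its `A.card` largest eigenvalues. -/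
theorem sum_diag_add_offDiag_le {d : ℕ} {l : Fin d → ℝ} (hl : Antitone l)
    (l0 : ∀ k, 0 ≤ l k) (l1 : ∀ k, l k ≤ 1) {W ρ : Matrix (Fin d) (Fin d) ℂ}
    (hW : W * Wᴴ = 1) (hρ : ρ = W * diagonal (fun k => (l k : ℂ)) * Wᴴ)
    (A : Finset (Fin d)) :
    ∑ i ∈ A, (ρ i i).re + ∑ i ∈ A, ∑ j ∈ Aᶜ, Complex.normSq (ρ i j) ≤
      ∑ k with k.val < A.card, l k := by
  have hW' : Wᴴ * W = 1 := mul_eq_one_comm.1 hW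
  set D : Matrix (Fin d) (Fin d) ℂ := diagonal (fun k => (l k : ℂ)) with hD
  set E : Matrix (Fin d) (Fin d) ℂ := diagonal (fun i => if i ∈ A then 1 else 0) with hE
  have hEE : E * E = E := by
    rw [hE, diagonal_mul_diagonal]
    congr 1
    ext i
    split_ifs <;> simp
  have hEh : Eᴴ = E := by
    rw [hE, diagonal_conjTranspose]
    congr 1
    ext i
    simp only [Pi.star_apply]
    split_ifs <;> simp
  have hDh : Dᴴ = D := by
    rw [hD, diagonal_conjTranspose]
    congr 1
    ext i
    simp
  -- `P` is the coordinate projection onto `A`, seen in the eigenbasis of `ρ`. The identities `t1`,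
  -- `t2`, `t3` below evaluate `Tr Eρ`, `Tr Eρ²` and `Tr EρEρ` in both bases; the difference of the
  -- last two is the squared norm of the off-diagonal block.
  set P := Wᴴ * E * W with hP
  have hPh : Pᴴ = P := by
    simp only [hP, conjTranspose_mul, conjTranspose_conjTranspose, hEh, Matrix.mul_assoc]
  have hPP : P * P = P := by
    calc P * P = Wᴴ * E * (W * Wᴴ) * E * W := by simp only [hP, Matrix.mul_assoc]
      _ = P := by rw [hW, Matrix.mul_one, Matrix.mul_assoc Wᴴ, hEE]
  have hρh : ρᴴ = ρ := by
    simp only [hρ, conjTranspose_mul, conjTranspose_conjTranspose, hDh, Matrix.mul_assoc]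
  have conj_entry : ∀ {M : Matrix (Fin d) (Fin d) ℂ}, Mᴴ = M → ∀ i j,
      M i j * M j i = (Complex.normSq (M i j) : ℂ) := by
    intro M hM i j
    have : M j i = star (M i j) := by
      conv_lhs => rw [← hM, conjTranspose_apply]
    rw [this]
    exact Complex.mul_conj _
  have Prow : ∀ k, P k k = ((∑ m, Complex.normSq (P k m) : ℝ) : ℂ) := by
    intro k
    conv_lhs => rw [← hPP, mul_apply]
    push_cast
    exact Finset.sum_congr rfl fun m _ => conj_entry hPh k m
  have Pre : ∀ k, P k k = ((P k k).re : ℂ) := fun k => by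
    rw [Prow, Complex.ofReal_re]
  have key := sum_mul_add_sq_sub_le (K := A.card) (q := fun k => (P k k).re)
    (p := fun k m => Complex.normSq (P k m)) hl l0 l1 (fun k m => Complex.normSq_nonneg _)
    (fun k m => by
      have : P m k = star (P k m) := by
        conv_lhs => rw [← hPh, conjTranspose_apply]
      rw [this]
      exact (Complex.normSq_conj _).symm)
    (fun k => by
      show _ = (P k k).re
      rw [Prow, Complex.ofReal_re])
    (fun k => by
      show Complex.normSq (P k k) = (P k k).re ^ 2
      rw [Pre, Complex.normSq_ofReal, Complex.ofReal_re, sq])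
    (by
      have : P.trace = A.card := by
        rw [hP, trace_mul_cycle, hW, Matrix.one_mul, hE, trace_diagonal]
        simp
      have := congrArg Complex.re this
      simpa [trace] using this)
  have t1 : ∑ i ∈ A, (ρ i i).re = ∑ k, l k * (P k k).re := by
    have h : (E * ρ).trace = (P * D).trace := by
      rw [hρ, ← Matrix.mul_assoc, trace_mul_comm]
      simp only [hP, Matrix.mul_assoc]
    have := congrArg Complex.re h
    simpa [trace, hE, hD, diagonal_mul, mul_diagonal, ite_mul, Finset.sum_ite_mem, mul_comm,
      apply_ite Complex.re] using this
  have t2 : ∑ i ∈ A, ∑ j, Complex.normSq (ρ i j) = ∑ k, l k ^ 2 * (P k k).re := by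
    have h : (E * ρ * ρ).trace = (P * D * D).trace := by
      calc (E * ρ * ρ).trace = (E * W * D * (Wᴴ * W) * D * Wᴴ).trace := by
            simp only [hρ, Matrix.mul_assoc]
        _ = (P * D * D).trace := by
            rw [hW', Matrix.mul_one, trace_mul_comm]
            simp only [hP, Matrix.mul_assoc]
    have := congrArg Complex.re h
    have e : (E * ρ * ρ).trace = ((∑ i ∈ A, ∑ j, Complex.normSq (ρ i j) : ℝ) : ℂ) := by
      simp_rw [trace, diag_apply, mul_apply (M := E * ρ), hE, diagonal_mul]
      push_cast
      rw [← Finset.sum_subset (Finset.subset_univ A)]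
      · refine Finset.sum_congr rfl fun i hi => Finset.sum_congr rfl fun j _ => ?_
        rw [if_pos hi, one_mul, conj_entry hρh]
      · intro i _ hi
        simp [hi]
    rw [e, Complex.ofReal_re] at this
    rw [this]
    simp only [trace, diag_apply, hD, mul_diagonal, Complex.re_sum]
    refine Finset.sum_congr rfl fun k _ => ?_
    simp
    ring
  have t3 : ∑ i ∈ A, ∑ j ∈ A, Complex.normSq (ρ i j) =
      ∑ k, ∑ m, l k * l m * Complex.normSq (P k m) := by
    have h : (E * ρ * (E * ρ)).trace = (P * D * (P * D)).trace := by
      calc (E * ρ * (E * ρ)).trace = (E * W * D * Wᴴ * E * W * D * Wᴴ).trace := by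
            simp only [hρ, Matrix.mul_assoc]
        _ = (P * D * (P * D)).trace := by
            rw [trace_mul_comm]
            simp only [hP, Matrix.mul_assoc]
    have e : (E * ρ * (E * ρ)).trace = ((∑ i ∈ A, ∑ j ∈ A, Complex.normSq (ρ i j) : ℝ) : ℂ) := by
      simp_rw [trace, diag_apply, mul_apply (M := E * ρ), hE, diagonal_mul]
      push_cast
      rw [← Finset.sum_subset (Finset.subset_univ A)]
      · refine Finset.sum_congr rfl fun i hi => ?_
        rw [← Finset.sum_subset (Finset.subset_univ A)]
        · refine Finset.sum_congr rfl fun j hj => ?_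
          rw [if_pos hi, if_pos hj, one_mul, one_mul, conj_entry hρh]
        · intro j _ hj
          simp [hj]
      · intro i _ hi
        simp [hi]
    have e' : (P * D * (P * D)).trace =
        ((∑ k, ∑ m, l k * l m * Complex.normSq (P k m) : ℝ) : ℂ) := by
      simp_rw [trace, diag_apply, mul_apply (M := P * D), hD, mul_diagonal]
      push_cast
      refine Finset.sum_congr rfl fun k _ => Finset.sum_congr rfl fun m _ => ?_
      rw [← conj_entry hPh]
      ring
    rw [e, e'] at h
    exact_mod_cast h
  have t4 : ∑ i ∈ A, ∑ j ∈ Aᶜ, Complex.normSq (ρ i j) =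
      ∑ i ∈ A, ∑ j, Complex.normSq (ρ i j) - ∑ i ∈ A, ∑ j ∈ A, Complex.normSq (ρ i j) := by
    rw [← Finset.sum_sub_distrib]
    refine Finset.sum_congr rfl fun i _ => ?_
    rw [← Finset.sum_add_sum_compl A]
    ring
  rw [t4, t1, t2, t3]
  exact key

/-! ### The majorization relation -/

/-- The combination `a ρ + (1 - a) σ - s i [ρ, σ]`. For `s = 0` it is the convex combination, for
`s = √(a (1 - a))` it is the partial swap addition rule. -/
noncomputable def swapSum {d : ℕ} (a s : ℝ) (ρ σ : Matrix (Fin d) (Fin d) ℂ) :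
    Matrix (Fin d) (Fin d) ℂ :=
  a • ρ + (1 - a) • σ - ((s : ℂ) * Complex.I) • (ρ * σ - σ * ρ)

theorem swapSum_isHermitian {d : ℕ} {ρ σ : Matrix (Fin d) (Fin d) ℂ} (hρ : ρ.IsHermitian)
    (hσ : σ.IsHermitian) (a s : ℝ) : (swapSum a s ρ σ).IsHermitian := by
  have h1 : star (a : ℝ) = a := star_trivial a
  have h2 : star (1 - a : ℝ) = 1 - a := star_trivial _
  simp only [IsHermitian, swapSum, conjTranspose_sub, conjTranspose_add, conjTranspose_smul,
    conjTranspose_mul, hρ.eq, hσ.eq, h1, h2]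
  rw [show star ((s : ℂ) * Complex.I) = -((s : ℂ) * Complex.I) by simp, neg_smul, ← smul_neg,
    neg_sub]

theorem trace_swapSum {d : ℕ} (ρ σ : Matrix (Fin d) (Fin d) ℂ) (a s : ℝ) :
    (swapSum a s ρ σ).trace = a • ρ.trace + (1 - a) • σ.trace := by
  simp [swapSum, trace_mul_comm ρ σ, trace_smul]

theorem swapSum_conj {d : ℕ} {V : Matrix (Fin d) (Fin d) ℂ} (hV : V * Vᴴ = 1)
    (ρ σ : Matrix (Fin d) (Fin d) ℂ) (a s : ℝ) :
    Vᴴ * swapSum a s ρ σ * V = swapSum a s (Vᴴ * ρ * V) (Vᴴ * σ * V) := by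
  have h : ∀ X Y : Matrix (Fin d) (Fin d) ℂ, Vᴴ * X * V * (Vᴴ * Y * V) = Vᴴ * (X * Y) * V := by
    intro X Y
    calc Vᴴ * X * V * (Vᴴ * Y * V) = Vᴴ * X * (V * Vᴴ) * Y * V := by
          simp only [Matrix.mul_assoc]
      _ = Vᴴ * (X * Y) * V := by simp only [hV, Matrix.mul_one, Matrix.mul_assoc]
  simp only [swapSum, h, Matrix.mul_add, Matrix.add_mul, Matrix.mul_sub, Matrix.sub_mul,
    Matrix.mul_smul, Matrix.smul_mul]

/-- The imaginary part is at most `2 |z| |w|` in modulus, so AM-GM applies after squaring. This is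
the only place where the size of the commutator coefficient matters for the majorization. -/
theorem commutator_im_le {a s : ℝ} (ha : a ∈ Set.Icc (0 : ℝ) 1) (hs : s ^ 2 ≤ a * (1 - a))
    (z w : ℂ) : s * (z * star w - w * star z).im ≤
      a * Complex.normSq z + (1 - a) * Complex.normSq w := by
  obtain ⟨h0, h1⟩ := ha
  have hab : 0 ≤ a * (1 - a) := mul_nonneg h0 (by linarith)
  have hz := Complex.normSq_nonneg z
  have hw := Complex.normSq_nonneg w
  refine le_of_abs_le (abs_le_of_sq_le_sq ?_
    (add_nonneg (mul_nonneg h0 hz) (mul_nonneg (by linarith) hw)))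
  have e : (z * star w - w * star z).im ^ 2 ≤ 4 * (Complex.normSq z * Complex.normSq w) := by
    simp [Complex.normSq_apply]
    nlinarith [sq_nonneg (z.re * w.re + z.im * w.im)]
  rw [mul_pow]
  calc s ^ 2 * (z * star w - w * star z).im ^ 2
      ≤ a * (1 - a) * (4 * (Complex.normSq z * Complex.normSq w)) :=
        mul_le_mul hs e (sq_nonneg _) hab
    _ ≤ _ := by nlinarith [sq_nonneg (a * Complex.normSq z - (1 - a) * Complex.normSq w)]

/-- The spectrum of `swapSum a s ρ σ` is majorized by the combination of the ordered spectra. -/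
theorem sum_spectrumVec_swapSum_le {d : ℕ} {ρ σ : Matrix (Fin d) (Fin d) ℂ}
    (hρ : ρ ∈ densityMatrices d) (hσ : σ ∈ densityMatrices d) {a s : ℝ}
    (ha : a ∈ Set.Icc (0 : ℝ) 1) (hs : s ^ 2 ≤ a * (1 - a)) (A : Finset (Fin d)) :
    ∑ i ∈ A, spectrumVec (swapSum a s ρ σ) i ≤
      ∑ k with k.val < A.card, (a • spectrumVec ρ + (1 - a) • spectrumVec σ) k := by
  obtain ⟨V, hV, hτ⟩ := exists_spectral_decomposition
    (swapSum_isHermitian hρ.1.isHermitian hσ.1.isHermitian a s)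
  have hV' : Vᴴ * V = 1 := mul_eq_one_comm.1 hV
  have block : ∀ {ρ : Matrix (Fin d) (Fin d) ℂ}, ρ ∈ densityMatrices d →
      ∑ i ∈ A, ((Vᴴ * ρ * V) i i).re + ∑ i ∈ A, ∑ j ∈ Aᶜ, Complex.normSq ((Vᴴ * ρ * V) i j) ≤
      ∑ k with k.val < A.card, spectrumVec ρ k := by
    intro ρ hρ
    obtain ⟨U, hU, hρU⟩ := exists_spectral_decomposition hρ.1.isHermitian
    have hmem := spectrumVec_mem_stdSimplex hρ
    refine sum_diag_add_offDiag_le (W := Vᴴ * U) (spectrumVec_antitone ρ) hmem.1 (fun k => ?_)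
      ?_ ?_ A
    · rw [← hmem.2]
      exact Finset.single_le_sum (fun i _ => hmem.1 i) (Finset.mem_univ k)
    · rw [conjTranspose_mul, conjTranspose_conjTranspose, Matrix.mul_assoc, ← Matrix.mul_assoc U,
        hU, Matrix.one_mul, hV']
    · conv_lhs => rw [hρU]
      simp only [conjTranspose_mul, conjTranspose_conjTranspose, Matrix.mul_assoc]
  have bρ := block hρ
  have bσ := block hσ
  have hR : (Vᴴ * ρ * V)ᴴ = Vᴴ * ρ * V := by
    simp only [conjTranspose_mul, conjTranspose_conjTranspose, hρ.1.isHermitian.eq,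
      Matrix.mul_assoc]
  have hS : (Vᴴ * σ * V)ᴴ = Vᴴ * σ * V := by
    simp only [conjTranspose_mul, conjTranspose_conjTranspose, hσ.1.isHermitian.eq,
      Matrix.mul_assoc]
  have hdiag : swapSum a s (Vᴴ * ρ * V) (Vᴴ * σ * V) =
      diagonal fun k => (spectrumVec (swapSum a s ρ σ) k : ℂ) := by
    rw [← swapSum_conj hV]
    conv_lhs => rw [hτ]
    calc Vᴴ * (V * diagonal (fun k => (spectrumVec (swapSum a s ρ σ) k : ℂ)) * Vᴴ) * V
        = (Vᴴ * V) * diagonal (fun k => (spectrumVec (swapSum a s ρ σ) k : ℂ)) * (Vᴴ * V) := by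
          simp only [Matrix.mul_assoc]
      _ = _ := by rw [hV', Matrix.one_mul, Matrix.mul_one]
  generalize spectrumVec (swapSum a s ρ σ) = x at *
  generalize Vᴴ * ρ * V = R at *
  generalize Vᴴ * σ * V = S at *
  let g : Fin d → Fin d → ℝ := fun i j => (R i j * S j i - S i j * R j i).im
  have hx : ∀ i, x i = a * (R i i).re + (1 - a) * (S i i).re + s * ∑ j, g i j := by
    intro i
    have h := congrArg Complex.re (congrFun (congrFun hdiag i) i)
    rw [diagonal_apply_eq, Complex.ofReal_re] at h
    rw [← h]
    simp only [swapSum, Matrix.sub_apply, Matrix.add_apply, Matrix.smul_apply, g, ← Complex.im_sum,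
      Finset.sum_sub_distrib, ← mul_apply, smul_eq_mul]
    simp
  -- `g` is antisymmetric, so only the block `A × Aᶜ` contributes.
  have hgA : ∑ i ∈ A, ∑ j ∈ A, g i j = 0 := by
    have : ∑ i ∈ A, ∑ j ∈ A, g i j = - ∑ i ∈ A, ∑ j ∈ A, g i j := by
      conv_lhs => rw [Finset.sum_comm]
      simp_rw [← Finset.sum_neg_distrib]
      refine Finset.sum_congr rfl fun i _ => Finset.sum_congr rfl fun j _ => ?_
      simp only [g, ← Complex.neg_im]
      congr 1
      ring
    linarith
  have hg : s * ∑ i ∈ A, ∑ j, g i j ≤ a * (∑ i ∈ A, ∑ j ∈ Aᶜ, Complex.normSq (R i j)) +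
      (1 - a) * ∑ i ∈ A, ∑ j ∈ Aᶜ, Complex.normSq (S i j) := by
    have e : ∑ i ∈ A, ∑ j, g i j = ∑ i ∈ A, ∑ j ∈ Aᶜ, g i j := by
      simp_rw [← Finset.sum_add_sum_compl A, Finset.sum_add_distrib]
      rw [hgA, zero_add]
    rw [e]
    simp_rw [Finset.mul_sum, ← Finset.sum_add_distrib]
    refine Finset.sum_le_sum fun i _ => Finset.sum_le_sum fun j _ => ?_
    have e1 : S j i = star (S i j) := by conv_lhs => rw [← hS, conjTranspose_apply]
    have e2 : R j i = star (R i j) := by conv_lhs => rw [← hR, conjTranspose_apply]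
    simp only [g, e1, e2]
    exact commutator_im_le ha hs _ _
  simp only [hx, Finset.sum_add_distrib, ← Finset.mul_sum, Pi.add_apply, Pi.smul_apply,
    smul_eq_mul]
  have h1 := mul_le_mul_of_nonneg_left bρ ha.1
  have h2 := mul_le_mul_of_nonneg_left bσ (sub_nonneg.2 ha.2)
  linarith

/-! ### The entropy power inequality -/

theorem le_comp_spectrumVec_swapSum {d : ℕ} {φ : (Fin d → ℝ) → ℝ}
    (hφ : ConcaveOn ℝ (stdSimplex ℝ (Fin d)) φ)
    (hsymm : ∀ (π : Equiv.Perm (Fin d)) (v : Fin d → ℝ), φ (v ∘ π) = φ v)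
    {ρ σ : Matrix (Fin d) (Fin d) ℂ} (hρ : ρ ∈ densityMatrices d) (hσ : σ ∈ densityMatrices d)
    {a s : ℝ} (ha : a ∈ Set.Icc (0 : ℝ) 1) (hs : s ^ 2 ≤ a * (1 - a)) :
    a * φ (spectrumVec ρ) + (1 - a) * φ (spectrumVec σ) ≤ φ (spectrumVec (swapSum a s ρ σ)) := by
  have mρ := spectrumVec_mem_stdSimplex hρ
  have mσ := spectrumVec_mem_stdSimplex hσ
  have h1 : 0 ≤ 1 - a := sub_nonneg.2 ha.2
  have hmem := hφ.1 mρ mσ ha.1 h1 (by ring)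
  refine (hφ.2 mρ mσ ha.1 h1 (by ring)).trans
    (le_of_majorized hφ hsymm hmem (sum_spectrumVec_swapSum_le hρ hσ ha hs) ?_)
  rw [hmem.2]
  have h := sum_spectrumVec (swapSum_isHermitian hρ.1.isHermitian hσ.1.isHermitian a s)
  rw [trace_swapSum, hρ.2, hσ.2, ← add_smul, add_sub_cancel, one_smul] at h
  exact_mod_cast h

theorem convex_densityMatrices (d : ℕ) : Convex ℝ (densityMatrices d) := by
  intro ρ hρ σ hσ a b ha hb hab
  refine ⟨(hρ.1.smul ha).add (hσ.1.smul hb), ?_⟩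
  rw [trace_add, trace_smul, trace_smul, hρ.2, hσ.2, ← add_smul, hab, one_smul]

/-- A symmetric concave function of the eigenvalues is a concave function of the matrix. -/
theorem comp_spectrumVec_mem_classF {d : ℕ} {φ : (Fin d → ℝ) → ℝ}
    (hφ : ConcaveOn ℝ (stdSimplex ℝ (Fin d)) φ)
    (hsymm : ∀ (π : Equiv.Perm (Fin d)) (v : Fin d → ℝ), φ (v ∘ π) = φ v) :
    (fun ρ => φ (spectrumVec ρ)) ∈ classF d := by
  refine ⟨⟨convex_densityMatrices d, ?_⟩, φ, hsymm, fun _ _ => rfl⟩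
  intro ρ hρ σ hσ a b ha hb hab
  obtain rfl : b = 1 - a := by linarith
  -- At `s = 0` the combination is the ordinary convex one.
  have h := le_comp_spectrumVec_swapSum hφ hsymm hρ hσ (a := a) (s := 0) ⟨ha, by linarith⟩
    (by simpa using mul_nonneg ha hb)
  simpa [swapSum] using h

/-- The function of the eigenvalues that defines a member of the class is concave on the
simplex. -/
theorem concaveOn_of_comp_spectrumVec {d : ℕ} {f : Matrix (Fin d) (Fin d) ℂ → ℝ}
    {φ : (Fin d → ℝ) → ℝ} (hf : ConcaveOn ℝ (densityMatrices d) f)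
    (hsymm : ∀ (π : Equiv.Perm (Fin d)) (v : Fin d → ℝ), φ (v ∘ π) = φ v)
    (hfφ : ∀ ρ ∈ densityMatrices d, f ρ = φ (spectrumVec ρ)) :
    ConcaveOn ℝ (stdSimplex ℝ (Fin d)) φ := by
  -- The simplex embeds affinely as the diagonal states; the sorting of the spectrum is invisible to
  -- the symmetric `φ`.
  have hmem : ∀ v ∈ stdSimplex ℝ (Fin d),
      (diagonal fun k => (v k : ℂ)) ∈ densityMatrices d := by
    intro v hv
    refine ⟨PosSemidef.diagonal fun k => ?_, ?_⟩
    · simpa using hv.1 k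
    · rw [trace_diagonal]
      exact_mod_cast hv.2
  have hval : ∀ v ∈ stdSimplex ℝ (Fin d), φ v = f (diagonal fun k => (v k : ℂ)) := by
    intro v hv
    obtain ⟨π, hπ⟩ := exists_spectrumVec_diagonal v
    rw [hfφ _ (hmem v hv), hπ, hsymm]
  refine ⟨convex_stdSimplex ℝ (Fin d), ?_⟩
  intro v hv w hw a b ha hb hab
  rw [hval v hv, hval w hw, hval _ (convex_stdSimplex ℝ (Fin d) hv hw ha hb hab)]
  refine (hf.2 (hmem v hv) (hmem w hw) ha hb hab).trans_eq ?_
  congr 1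
  ext i j
  by_cases hij : i = j
  · subst hij
    simp
  · simp [hij]

/-! ### Positivity of the partial swap sum -/

theorem posSemidef_sub_mul_self {d : ℕ} {ρ : Matrix (Fin d) (Fin d) ℂ}
    (hρ : ρ ∈ densityMatrices d) : (ρ - ρ * ρ).PosSemidef := by
  obtain ⟨U, hU, h⟩ := exists_spectral_decomposition hρ.1.isHermitian
  have hU' : Uᴴ * U = 1 := mul_eq_one_comm.1 hU
  have hmem := spectrumVec_mem_stdSimplex hρ
  have h1 : ∀ k, spectrumVec ρ k ≤ 1 := fun k => by
    rw [← hmem.2]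
    exact Finset.single_le_sum (fun i _ => hmem.1 i) (Finset.mem_univ k)
  have e : ρ - ρ * ρ =
      U * diagonal (fun k => ((spectrumVec ρ k * (1 - spectrumVec ρ k) : ℝ) : ℂ)) * Uᴴ := by
    have hsq : ρ * ρ = U * (diagonal (fun k => (spectrumVec ρ k : ℂ)) *
        diagonal (fun k => (spectrumVec ρ k : ℂ))) * Uᴴ := by
      conv_lhs => rw [h]
      calc _ = U * diagonal (fun k => (spectrumVec ρ k : ℂ)) * (Uᴴ * U) *
            diagonal (fun k => (spectrumVec ρ k : ℂ)) * Uᴴ := by simp only [Matrix.mul_assoc]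
        _ = _ := by rw [hU', Matrix.mul_one]; simp only [Matrix.mul_assoc]
    rw [hsq]
    nth_rewrite 1 [h]
    rw [← Matrix.sub_mul, ← Matrix.mul_sub, diagonal_mul_diagonal, diagonal_sub]
    congr 3
    ext k
    push_cast
    ring
  rw [e]
  refine PosSemidef.mul_mul_conjTranspose_same (PosSemidef.diagonal fun k => ?_) U
  exact Complex.zero_le_real.2 (mul_nonneg (hmem.1 k) (sub_nonneg.2 (h1 k)))

/-- Positivity comes from completing a square: with `Y = √a ρ + i √(1 - a) σ`, the cross terms of `Y
Yᴴ` are exactly the commutator term, and the surplus `a ρ² + (1 - a) σ²` is paid for by `ρ² ≤ ρ` and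
`σ² ≤ σ`. -/
theorem boxplus_mem_densityMatrices {d : ℕ} {ρ σ : Matrix (Fin d) (Fin d) ℂ}
    (hρ : ρ ∈ densityMatrices d) (hσ : σ ∈ densityMatrices d) {a : ℝ}
    (ha : a ∈ Set.Icc (0 : ℝ) 1) : boxplus a ρ σ ∈ densityMatrices d := by
  have h1 : 0 ≤ 1 - a := sub_nonneg.2 ha.2
  refine ⟨?_, ?_⟩
  · set Y : Matrix (Fin d) (Fin d) ℂ :=
      (Real.sqrt a : ℂ) • ρ + (Complex.I * (Real.sqrt (1 - a) : ℂ)) • σ with hY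
    have hYh : Yᴴ = (Real.sqrt a : ℂ) • ρ - (Complex.I * (Real.sqrt (1 - a) : ℂ)) • σ := by
      rw [hY, conjTranspose_add, conjTranspose_smul, conjTranspose_smul, hρ.1.isHermitian.eq,
        hσ.1.isHermitian.eq]
      simp [sub_eq_add_neg]
    have e : boxplus a ρ σ = a • (ρ - ρ * ρ) + (1 - a) • (σ - σ * σ) + Y * Yᴴ := by
      have ea : (Real.sqrt a : ℂ) * (Real.sqrt a : ℂ) = (a : ℂ) := by
        exact_mod_cast Real.mul_self_sqrt ha.1
      have eb : (Real.sqrt (1 - a) : ℂ) * (Real.sqrt (1 - a) : ℂ) = 1 - (a : ℂ) := by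
        exact_mod_cast Real.mul_self_sqrt h1
      have eI := Complex.I_mul_I
      rw [hYh, hY, boxplus, Real.sqrt_mul ha.1, ← Complex.coe_smul a, ← Complex.coe_smul a,
        ← Complex.coe_smul (1 - a), ← Complex.coe_smul (1 - a)]
      push_cast
      simp only [Matrix.mul_sub, Matrix.add_mul, Matrix.mul_smul, Matrix.smul_mul, smul_sub,
        smul_add]
      match_scalars
      all_goals first
        | ring1
        | linear_combination -ea
        | linear_combination (Real.sqrt (1 - a) : ℂ) ^ 2 * eI - eb
    rw [e]
    exact (((posSemidef_sub_mul_self hρ).smul ha.1).add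
      ((posSemidef_sub_mul_self hσ).smul h1)).add (posSemidef_self_mul_conjTranspose Y)
  · have h := trace_swapSum ρ σ a (Real.sqrt (a * (1 - a)))
    rw [hρ.2, hσ.2, ← add_smul, add_sub_cancel, one_smul] at h
    exact h

theorem le_boxplus {d : ℕ} {f : Matrix (Fin d) (Fin d) ℂ → ℝ} (hf : f ∈ classF d)
    {ρ σ : Matrix (Fin d) (Fin d) ℂ} (hρ : ρ ∈ densityMatrices d) (hσ : σ ∈ densityMatrices d)
    {a : ℝ} (ha : a ∈ Set.Icc (0 : ℝ) 1) :
    a * f ρ + (1 - a) * f σ ≤ f (boxplus a ρ σ) := by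
  obtain ⟨hconc, φ, hsymm, hfφ⟩ := hf
  rw [hfφ ρ hρ, hfφ σ hσ, hfφ _ (boxplus_mem_densityMatrices hρ hσ ha)]
  exact le_comp_spectrumVec_swapSum (concaveOn_of_comp_spectrumVec hconc hsymm hfφ) hsymm hρ hσ ha
    (Real.sq_sqrt (mul_nonneg ha.1 (sub_nonneg.2 ha.2))).le

/-! ### Von Neumann and Rényi entropies -/

theorem concaveOn_sum_stdSimplex {d : ℕ} {g : ℝ → ℝ} (hg : ConcaveOn ℝ (Set.Ici 0) g) :
    ConcaveOn ℝ (stdSimplex ℝ (Fin d)) fun v => ∑ i, g (v i) := by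
  refine ⟨convex_stdSimplex ℝ (Fin d), ?_⟩
  intro v hv w hw a b ha hb hab
  simp only [smul_eq_mul, Finset.mul_sum, ← Finset.sum_add_distrib]
  exact Finset.sum_le_sum fun i _ => hg.2 (hv.1 i) (hw.1 i) ha hb hab

theorem vonNeumannEntropy_mem_classF (d : ℕ) : vonNeumannEntropy ∈ classF d := by
  have h := comp_spectrumVec_mem_classF (concaveOn_sum_stdSimplex (d := d)
    Real.concaveOn_negMulLog) (fun π v => Equiv.sum_comp π fun i => Real.negMulLog (v i))
  convert h using 1
  ext ρ
  simp [vonNeumannEntropy, Real.negMulLog]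

theorem exists_pos_of_mem_stdSimplex {d : ℕ} {v : Fin d → ℝ} (hv : v ∈ stdSimplex ℝ (Fin d)) :
    ∃ i, 0 < v i := by
  by_contra! h
  have := Finset.sum_nonpos fun i (_ : i ∈ Finset.univ) => h i
  rw [hv.2] at this
  linarith

theorem concaveOn_log_sum_rpow {d : ℕ} {α : ℝ} (h0 : 0 < α) (h1 : α ≤ 1) :
    ConcaveOn ℝ (stdSimplex ℝ (Fin d)) fun v => Real.log (∑ i, v i ^ α) := by
  have hc := concaveOn_sum_stdSimplex (d := d) (Real.concaveOn_rpow h0.le h1)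
  have hpos : ∀ v ∈ stdSimplex ℝ (Fin d), 0 < ∑ i, v i ^ α := by
    intro v hv
    obtain ⟨i, hi⟩ := exists_pos_of_mem_stdSimplex hv
    exact Finset.sum_pos' (fun j _ => Real.rpow_nonneg (hv.1 j) α)
      ⟨i, Finset.mem_univ i, Real.rpow_pos_of_pos hi α⟩
  refine ⟨hc.1, ?_⟩
  intro v hv w hw a b ha hb hab
  have hv' := hpos v hv
  have hw' := hpos w hw
  refine (strictConcaveOn_log_Ioi.concaveOn.2 hv' hw' ha hb hab).trans ?_
  refine Real.log_le_log ?_ (hc.2 hv hw ha hb hab)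
  exact (convex_Ioi (0 : ℝ)) hv' hw' ha hb hab

/-- A proper mixture of nonnegative vectors has support containing both supports, so its value
dominates both values and hence their average. -/
theorem concaveOn_log_card_support (d : ℕ) :
    ConcaveOn ℝ (stdSimplex ℝ (Fin d)) fun v =>
      Real.log (Finset.card {i | v i ≠ 0} : ℕ) := by
  refine ⟨convex_stdSimplex ℝ (Fin d), ?_⟩
  intro v hv w hw a b ha hb hab
  rcases ha.eq_or_lt with rfl | ha
  · obtain rfl : b = 1 := by linarith
    simp
  rcases hb.eq_or_lt with rfl | hb
  · obtain rfl : a = 1 := by linarith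
    simp
  have hpos : ∀ u ∈ stdSimplex ℝ (Fin d), 0 < ((Finset.card {i | u i ≠ 0} : ℕ) : ℝ) := by
    intro u hu
    obtain ⟨i, hi⟩ := exists_pos_of_mem_stdSimplex hu
    exact_mod_cast Finset.card_pos.2 ⟨i, by simpa using hi.ne'⟩
  have hle : ∀ u : Fin d → ℝ, u ∈ stdSimplex ℝ (Fin d) →
      (∀ i, 0 < u i → 0 < (a • v + b • w) i) →
      Real.log (Finset.card {i | u i ≠ 0} : ℕ) ≤
        Real.log (Finset.card {i | (a • v + b • w) i ≠ 0} : ℕ) := by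
    intro u hu hi
    refine Real.log_le_log (hpos u hu) ?_
    norm_cast
    refine Finset.card_le_card fun i h => ?_
    simp only [Finset.mem_filter, Finset.mem_univ, true_and] at h ⊢
    exact (hi i ((hu.1 i).lt_of_ne' h)).ne'
  have h1 := hle v hv fun i hi => by
    have := mul_nonneg hb.le (hw.1 i)
    have := mul_pos ha hi
    simp only [Pi.add_apply, Pi.smul_apply, smul_eq_mul]
    linarith
  have h2 := hle w hw fun i hi => by
    have := mul_nonneg ha.le (hv.1 i)
    have := mul_pos hb hi
    simp only [Pi.add_apply, Pi.smul_apply, smul_eq_mul]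
    linarith
  simp only [smul_eq_mul]
  calc _ ≤ a * Real.log (Finset.card {i | (a • v + b • w) i ≠ 0} : ℕ) +
        b * Real.log (Finset.card {i | (a • v + b • w) i ≠ 0} : ℕ) := by gcongr
    _ = _ := by rw [← add_mul, hab, one_mul]

theorem renyiEntropy_mem_classF (d : ℕ) {α : ℝ} (hα : α ∈ Set.Ico (0 : ℝ) 1) :
    renyiEntropy α ∈ classF d := by
  have hc : ConcaveOn ℝ (stdSimplex ℝ (Fin d)) fun v =>
      Real.log (∑ i with v i ≠ 0, v i ^ α) := by
    -- At `α = 0` each term is `1`, so the filtered sum counts the support. For `α > 0` the filter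
    -- is harmless since `0 ^ α = 0`.
    rcases hα.1.eq_or_lt with rfl | h0
    · simpa using concaveOn_log_card_support d
    · convert concaveOn_log_sum_rpow (d := d) h0 hα.2.le using 3 with v
      rw [Finset.sum_filter]
      refine Finset.sum_congr rfl fun i _ => ?_
      split_ifs with h
      · rfl
      · rw [not_not.1 h, Real.zero_rpow h0.ne']
  refine comp_spectrumVec_mem_classF
    (φ := fun v => 1 / (1 - α) * Real.log (∑ i with v i ≠ 0, v i ^ α)) ?_ ?_
  · exact hc.smul (one_div_nonneg.2 (sub_nonneg.2 hα.2.le))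
  · intro π v
    simp only [Finset.sum_filter, Function.comp_apply]
    rw [Equiv.sum_comp π fun i => if v i ≠ 0 then v i ^ α else 0]

open MeasureTheory

/-! ### Subentropy -/

theorem hasDerivAt_log_add_sub_log_add {x t : ℝ} (hx : 0 < x) (ht : 0 ≤ t) :
    HasDerivAt (fun t => Real.log (1 + t) - Real.log (x + t)) (1 / (1 + t) - 1 / (x + t)) t := by
  have h : ∀ {y : ℝ}, 0 < y → HasDerivAt (fun t => Real.log (y + t)) (1 / (y + t)) t := fun hy =>
    ((hasDerivAt_id t).const_add _).log (by simp only [id]; linarith)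
  exact (h one_pos).sub (h hx)

theorem tendsto_log_add_sub_log_add {x : ℝ} (hx : 0 < x) :
    Filter.Tendsto (fun t => Real.log (1 + t) - Real.log (x + t)) Filter.atTop (𝓝 0) := by
  have h1 : Filter.Tendsto (fun t : ℝ => 1 + (1 - x) / (x + t)) Filter.atTop (𝓝 1) := by
    simpa using ((Filter.tendsto_atTop_add_const_left _ x
      Filter.tendsto_id).const_div_atTop (1 - x)).const_add 1
  have h2 := (Real.continuousAt_log one_ne_zero).tendsto.comp h1
  rw [Real.log_one] at h2
  refine h2.congr' ?_
  filter_upwards [Filter.eventually_ge_atTop 0] with t ht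
  have h3 : x + t ≠ 0 := by positivity
  rw [Function.comp_apply, ← Real.log_div (by positivity) h3]
  congr 1
  field_simp
  ring

theorem integrableOn_inv_sub_inv {x : ℝ} (hx : 0 < x) :
    IntegrableOn (fun t => 1 / (1 + t) - 1 / (x + t)) (Set.Ioi 0) := by
  -- The integrand has constant sign on either side of `x = 1`, so a limit of the antiderivative at
  -- infinity already gives integrability.
  rcases le_total x 1 with h | h
  · refine integrableOn_Ioi_deriv_of_nonpos' (fun t ht => hasDerivAt_log_add_sub_log_add hx ht)
      (fun t ht => ?_) (tendsto_log_add_sub_log_add hx)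
    have ht : 0 < t := ht
    exact sub_nonpos.2 (one_div_le_one_div_of_le (by positivity) (by linarith))
  · refine integrableOn_Ioi_deriv_of_nonneg' (fun t ht => hasDerivAt_log_add_sub_log_add hx ht)
      (fun t ht => ?_) (tendsto_log_add_sub_log_add hx)
    have ht : 0 < t := ht
    exact sub_nonneg.2 (one_div_le_one_div_of_le (by positivity) (by linarith))

theorem integral_inv_sub_inv {x : ℝ} (hx : 0 < x) :
    ∫ t in Set.Ioi (0 : ℝ), (1 / (1 + t) - 1 / (x + t)) = Real.log x := by
  rw [integral_Ioi_of_hasDerivAt_of_tendsto'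
    (fun t ht => hasDerivAt_log_add_sub_log_add hx ht) (integrableOn_inv_sub_inv hx)
    (tendsto_log_add_sub_log_add hx)]
  simp

/-! ### Divided differences by Lagrange interpolation -/

section Interpolation

open Polynomial

/-- `X ^ d` has degree one too many for interpolation at `d` nodes. Subtracting the nodal polynomial
lowers the degree and leaves the values at the nodes unchanged. -/
theorem degree_X_pow_sub_nodal_lt {d : ℕ} (μ : Fin d → ℝ) :
    (X ^ d - Lagrange.nodal Finset.univ μ).degree <
      ((Finset.univ : Finset (Fin d)).card : WithBot ℕ) := by
  have h : (X ^ d : ℝ[X]).degree = (Lagrange.nodal Finset.univ μ).degree := by simp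
  refine (degree_sub_lt_left h (monic_X_pow d).ne_zero ?_).trans_eq (by simp)
  rw [(monic_X_pow d).leadingCoeff, (Lagrange.nodal_monic (s := Finset.univ)).leadingCoeff]

theorem eval_X_pow_sub_nodal {d : ℕ} (μ : Fin d → ℝ) (i : Fin d) :
    (X ^ d - Lagrange.nodal Finset.univ μ).eval (μ i) = μ i ^ d := by
  simp [Lagrange.eval_nodal_at_node (Finset.mem_univ i)]

/-- The divided difference of `x ^ d` at `d` nodes is the sum of the nodes. -/
theorem sum_pow_div_prod_sub {d : ℕ} {μ : Fin d → ℝ} (hμ : Function.Injective μ) :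
    ∑ i, μ i ^ d / (∏ j ∈ Finset.univ.erase i, (μ i - μ j)) = ∑ i, μ i := by
  rcases Nat.eq_zero_or_pos d with rfl | hd
  · simp
  have h := Lagrange.coeff_eq_sum hμ.injOn (degree_X_pow_sub_nodal_lt μ)
  simp only [eval_X_pow_sub_nodal] at h
  rw [← h, coeff_sub, coeff_X_pow, Lagrange.nodal_eq,
    prod_X_sub_C_coeff_card_pred _ _ (by simpa using hd)]
  simp
  omega

/-- The divided difference of `x ^ d / (x + t)` at `d` nodes. -/
theorem sum_pow_div_prod_sub_div_add {d : ℕ} {μ : Fin d → ℝ} (hμ : Function.Injective μ)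
    (hpos : ∀ i, 0 < μ i) {t : ℝ} (ht : 0 < t) :
    ∑ i, μ i ^ d / (∏ j ∈ Finset.univ.erase i, (μ i - μ j)) * (1 / (μ i + t)) =
      1 - ∏ i, t / (t + μ i) := by
  have hne : ∀ i, t + μ i ≠ 0 := fun i => (add_pos ht (hpos i)).ne'
  -- Evaluating the interpolation formula at `-t` and dividing by `∏ (t + μ i)` gives the identity;
  -- the rest is bookkeeping of signs.
  have h := congrArg (eval (-t)) (Lagrange.eq_interpolate hμ.injOn (degree_X_pow_sub_nodal_lt μ))
  simp only [eval_X_pow_sub_nodal] at h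
  rw [Lagrange.interpolate_eq_sum, eval_finsetSum] at h
  simp only [eval_sub, eval_pow, eval_X, Lagrange.eval_nodal, eval_mul, eval_C, eval_prod] at h
  have hneg : ∀ s : Finset (Fin d), ∏ i ∈ s, (-t - μ i) = (-1) ^ s.card * ∏ i ∈ s, (t + μ i) := by
    intro s
    rw [← Finset.prod_const, ← Finset.prod_mul_distrib]
    exact Finset.prod_congr rfl fun i _ => by ring
  have hP : ∏ i, (t + μ i) ≠ 0 := Finset.prod_ne_zero_iff.2 fun i _ => hne i
  rw [Finset.prod_div_distrib, Finset.prod_const, Finset.card_univ, Fintype.card_fin,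
    eq_sub_iff_add_eq, ← eq_sub_iff_add_eq', ← mul_left_inj' hP, sub_mul, div_mul_cancel₀ _ hP,
    Finset.sum_mul]
  have e : ∀ i, μ i ^ d / (∏ j ∈ Finset.univ.erase i, (μ i - μ j)) * (1 / (μ i + t)) *
      ∏ i, (t + μ i) = -((-1) ^ d * (μ i ^ d / (∏ j ∈ Finset.univ.erase i, (μ i - μ j)) *
        ∏ j ∈ Finset.univ.erase i, (-t - μ j))) := by
    intro i
    rw [hneg, ← Finset.mul_prod_erase _ _ (Finset.mem_univ i),
      Finset.card_erase_of_mem (Finset.mem_univ i), Finset.card_univ, Fintype.card_fin]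
    obtain ⟨n, rfl⟩ : ∃ n, d = n + 1 := ⟨d - 1, by have := i.2; omega⟩
    have h1 : ((-1 : ℝ)) ^ (n + 1) * (-1) ^ n = -1 := by
      rw [pow_succ, mul_right_comm, ← mul_pow]
      norm_num
    have h2 : (1 / (μ i + t)) * (t + μ i) = 1 := by
      rw [add_comm t]
      exact one_div_mul_cancel (by rw [add_comm]; exact hne i)
    rw [Nat.add_sub_cancel]
    generalize ∏ j ∈ Finset.univ.erase i, (t + μ j) = p
    generalize μ i ^ (n + 1) / (∏ j ∈ Finset.univ.erase i, (μ i - μ j)) = c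
    linear_combination c * p * h2 + c * p * h1
  rw [Finset.sum_congr rfl fun i _ => e i, Finset.sum_neg_distrib, ← Finset.mul_sum, ← h, hneg,
    Finset.card_univ, Fintype.card_fin]
  have h1 : ((-1 : ℝ)) ^ d * (-1) ^ d = 1 := by
    rw [← mul_pow]
    norm_num
  rw [neg_pow t d]
  linear_combination (∏ i, (t + μ i) - t ^ d) * h1

end Interpolation

/-- The integrand of the integral representation of the subentropy. -/
noncomputable def subentropyIntegrand {d : ℕ} (μ : Fin d → ℝ) (t : ℝ) : ℝ :=
  1 - (∑ i, μ i) / (1 + t) - ∏ i, t / (t + μ i)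

/-- Write each logarithm as `∫ (1/(1+t) - 1/(x+t)) dt`. The weights in front then sum in closed
form, and the singular denominators `μ i - μ j` disappear. -/
theorem subentropyExpr_eq_integral {d : ℕ} {μ : Fin d → ℝ} (hμ : Function.Injective μ)
    (hpos : ∀ i, 0 < μ i) :
    subentropyExpr μ = ∫ t in Set.Ioi (0 : ℝ), subentropyIntegrand μ t := by
  have e : ∀ t ∈ Set.Ioi (0 : ℝ), subentropyIntegrand μ t =
      -∑ i, μ i ^ d / (∏ j ∈ Finset.univ.erase i, (μ i - μ j)) *
        (1 / (1 + t) - 1 / (μ i + t)) := by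
    intro t ht
    simp only [mul_sub, Finset.sum_sub_distrib]
    rw [sum_pow_div_prod_sub_div_add hμ hpos ht, ← Finset.sum_mul, sum_pow_div_prod_sub hμ,
      subentropyIntegrand]
    ring
  rw [setIntegral_congr_fun measurableSet_Ioi e, integral_neg, integral_finsetSum]
  · simp only [integral_const_mul, integral_inv_sub_inv (hpos _)]
    rfl
  · intro i _
    exact (integrableOn_inv_sub_inv (hpos i)).const_mul _

/-! ### Domination of the integrand and existence of the limit -/

theorem prod_div_add_le {ι : Type*} (s : Finset ι) {μ : ι → ℝ} (h0 : ∀ i, 0 ≤ μ i) {t : ℝ}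
    (ht : 0 < t) : ∏ i ∈ s, t / (t + μ i) ≤ t / (t + ∑ i ∈ s, μ i) := by
  classical
  induction s using Finset.induction_on with
  | empty => simp [ht.ne']
  | insert i s hi ih =>
    rw [Finset.prod_insert hi, Finset.sum_insert hi]
    have hS : 0 ≤ ∑ i ∈ s, μ i := Finset.sum_nonneg fun j _ => h0 j
    have hm := h0 i
    calc _ ≤ t / (t + μ i) * (t / (t + ∑ i ∈ s, μ i)) := by gcongr
      _ ≤ _ := by
        rw [div_mul_div_comm, div_le_div_iff₀ (by positivity) (by positivity)]
        nlinarith [mul_nonneg hm hS, mul_nonneg (mul_nonneg hm hS) ht.le]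

theorem one_sub_div_le_prod {ι : Type*} (s : Finset ι) {μ : ι → ℝ} (h0 : ∀ i, 0 ≤ μ i) {t : ℝ}
    (ht : 0 < t) : 1 - (∑ i ∈ s, μ i) / t ≤ ∏ i ∈ s, t / (t + μ i) := by
  classical
  induction s using Finset.induction_on with
  | empty => simp
  | insert i s hi ih =>
    rw [Finset.prod_insert hi, Finset.sum_insert hi]
    have hm := h0 i
    have hP1 : ∏ i ∈ s, t / (t + μ i) ≤ 1 := Finset.prod_le_one
      (fun j _ => div_nonneg ht.le (add_nonneg ht.le (h0 j)))
      (fun j _ => div_le_one_of_le₀ (by linarith [h0 j]) (add_nonneg ht.le (h0 j)))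
    have e : t / (t + μ i) = 1 - μ i / (t + μ i) := by
      have : t + μ i ≠ 0 := by positivity
      field_simp
      ring
    have h1 : μ i / (t + μ i) ≤ μ i / t := by gcongr; linarith
    have h2 : 0 ≤ μ i / (t + μ i) := by positivity
    rw [e, add_div]
    nlinarith

/-- For `t ≤ 1` every term is bounded. For `t ≥ 1` the two bounds on the product pin it down to
first order in `1/t`, and the `1/t` terms cancel. The total is left arbitrary because the vectors
approaching a spectrum need not have sum one. -/
theorem abs_subentropyIntegrand_le {d : ℕ} {μ : Fin d → ℝ} (h0 : ∀ i, 0 ≤ μ i) {t : ℝ}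
    (ht : 0 < t) :
    |subentropyIntegrand μ t| ≤ 2 * (1 + ∑ i, μ i) ^ 2 * (1 + t ^ 2)⁻¹ := by
  have hu := prod_div_add_le Finset.univ h0 ht
  have hl := one_sub_div_le_prod Finset.univ h0 ht
  have hS : 0 ≤ ∑ i, μ i := Finset.sum_nonneg fun j _ => h0 j
  have hP0 : 0 ≤ ∏ i, t / (t + μ i) :=
    Finset.prod_nonneg fun j _ => div_nonneg ht.le (add_nonneg ht.le (h0 j))
  have hP1 : ∏ i, t / (t + μ i) ≤ 1 := Finset.prod_le_one
      (fun j _ => div_nonneg ht.le (add_nonneg ht.le (h0 j)))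
      (fun j _ => div_le_one_of_le₀ (by linarith [h0 j]) (add_nonneg ht.le (h0 j)))
  unfold subentropyIntegrand
  generalize ∏ i, t / (t + μ i) = P at *
  generalize ∑ i, μ i = S at *
  rw [← div_eq_mul_inv]
  rcases le_total t 1 with h | h
  · have h1 : S / (1 + t) ≤ S := div_le_self hS (by linarith)
    have h2 : 0 ≤ S / (1 + t) := by positivity
    have h3 : (1 + S) ^ 2 ≤ 2 * (1 + S) ^ 2 / (1 + t ^ 2) := by
      rw [le_div_iff₀ (by positivity)]
      nlinarith [sq_nonneg (1 + S), mul_nonneg (sq_nonneg (1 + S)) (show 0 ≤ 1 - t ^ 2 by nlinarith)]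
    refine (abs_le.2 ⟨?_, ?_⟩ : _ ≤ (1 + S) ^ 2).trans h3 <;> nlinarith
  · have h3 : (1 + S) ^ 2 / t ^ 2 ≤ 2 * (1 + S) ^ 2 / (1 + t ^ 2) := by
      rw [div_le_div_iff₀ (by positivity) (by positivity)]
      nlinarith [mul_nonneg (sq_nonneg (1 + S)) (show 0 ≤ t ^ 2 - 1 by nlinarith)]
    refine (abs_le.2 ⟨?_, ?_⟩ : _ ≤ (1 + S) ^ 2 / t ^ 2).trans h3
    · have e1 : 1 - S / (1 + t) - t / (t + S) = S * (1 - S) / ((t + S) * (1 + t)) := by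
        have : t + S ≠ 0 := by positivity
        have : 1 + t ≠ 0 := by positivity
        field_simp
        ring
      have e2 : -((1 + S) ^ 2 / t ^ 2) ≤ S * (1 - S) / ((t + S) * (1 + t)) := by
        rw [← neg_div, div_le_div_iff₀ (by positivity) (by positivity)]
        have : t ^ 2 ≤ (t + S) * (1 + t) := by nlinarith
        nlinarith [mul_le_mul_of_nonneg_left this (sq_nonneg (1 + S)),
          mul_nonneg hS (sq_nonneg t), sq_nonneg t]
      linarith
    · have e1 : S / t - S / (1 + t) = S / (t * (1 + t)) := by
        have : 1 + t ≠ 0 := by positivity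
        field_simp
        ring
      have e2 : S / (t * (1 + t)) ≤ (1 + S) ^ 2 / t ^ 2 := by
        apply div_le_div₀ (by positivity) (by nlinarith) (by positivity) (by nlinarith)
      linarith

theorem measurable_subentropyIntegrand {d : ℕ} (μ : Fin d → ℝ) :
    Measurable (subentropyIntegrand μ) := by
  unfold subentropyIntegrand
  fun_prop

theorem integrableOn_subentropyIntegrand {d : ℕ} {μ : Fin d → ℝ} (h0 : ∀ i, 0 ≤ μ i) :
    IntegrableOn (subentropyIntegrand μ) (Set.Ioi 0) := by
  refine Integrable.mono' (integrable_inv_one_add_sq.restrict.const_mul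
    (2 * (1 + ∑ i, μ i) ^ 2)) (measurable_subentropyIntegrand μ).aestronglyMeasurable ?_
  filter_upwards [ae_restrict_mem measurableSet_Ioi] with t ht
  exact abs_subentropyIntegrand_le h0 ht

theorem tendsto_integral_subentropyIntegrand {d : ℕ} {v : Fin d → ℝ} (hv : ∀ i, 0 ≤ v i) :
    Filter.Tendsto (fun μ => ∫ t in Set.Ioi (0 : ℝ), subentropyIntegrand μ t)
      (𝓝[{μ | Function.Injective μ ∧ ∀ i, 0 < μ i}] v)
      (𝓝 (∫ t in Set.Ioi (0 : ℝ), subentropyIntegrand v t)) := by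
  refine tendsto_integral_filter_of_dominated_convergence
    (fun t => 2 * (1 + (∑ i, v i + 1)) ^ 2 * (1 + t ^ 2)⁻¹)
    (Filter.Eventually.of_forall fun μ =>
      (measurable_subentropyIntegrand μ).aestronglyMeasurable) ?_
    (integrable_inv_one_add_sq.restrict.const_mul _) ?_
  · have hc : Filter.Tendsto (fun μ : Fin d → ℝ => ∑ i, μ i) (𝓝 v) (𝓝 (∑ i, v i)) :=
      (continuous_finsetSum _ fun i _ => continuous_apply i).tendsto v
    filter_upwards [self_mem_nhdsWithin, nhdsWithin_le_nhds
      (hc.eventually (Iio_mem_nhds (lt_add_one (∑ i, v i))))] with μ hμ hlt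
    have hlt : ∑ i, μ i < ∑ i, v i + 1 := hlt
    have hS : 0 ≤ ∑ i, μ i := Finset.sum_nonneg fun j _ => (hμ.2 j).le
    filter_upwards [ae_restrict_mem measurableSet_Ioi] with t ht
    refine (abs_subentropyIntegrand_le (fun i => (hμ.2 i).le) ht).trans ?_
    gcongr
  · filter_upwards [ae_restrict_mem measurableSet_Ioi] with t ht
    have ht : 0 < t := ht
    refine Filter.Tendsto.mono_left ?_ nhdsWithin_le_nhds
    have : ContinuousAt (fun μ : Fin d → ℝ => subentropyIntegrand μ t) v := by
      unfold subentropyIntegrand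
      have hne : ∀ i, t + v i ≠ 0 := fun i => (add_pos_of_pos_of_nonneg ht (hv i)).ne'
      refine (continuousAt_const.sub (ContinuousAt.div_const ?_ _)).sub ?_
      · fun_prop
      · exact tendsto_finsetProd _ fun i _ =>
          ContinuousAt.div continuousAt_const
            (continuousAt_const.add (continuous_apply i).continuousAt) (hne i)
    exact this

/-- Vectors with distinct positive entries are dense among nonnegative vectors. -/
theorem neBot_nhdsWithin_injective_pos {d : ℕ} {v : Fin d → ℝ} (hv : ∀ i, 0 ≤ v i) :
    (𝓝[{μ : Fin d → ℝ | Function.Injective μ ∧ ∀ i, 0 < μ i}] v).NeBot := by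
  rw [← mem_closure_iff_nhdsWithin_neBot]
  set s := Tuple.sort v
  -- Each entry is raised by `ε` times its rank in the sorted order. Ties are broken without
  -- reversing any inequality, and the `+ 1` makes the lowest entry positive too.
  have ht : Filter.Tendsto (fun (ε : ℝ) (i : Fin d) => v i + ε * ((s.symm i : ℕ) + 1)) (𝓝[>] 0)
      (𝓝 v) := by
    refine Filter.Tendsto.mono_left ?_ nhdsWithin_le_nhds
    rw [tendsto_pi_nhds]
    intro i
    have : Continuous fun ε : ℝ => v i + ε * (((s.symm i : Fin d) : ℕ) + 1) := by fun_prop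
    simpa using this.tendsto 0
  refine mem_closure_of_tendsto ht ?_
  filter_upwards [self_mem_nhdsWithin] with ε hε
  have hε : 0 < ε := hε
  refine ⟨?_, fun i => add_pos_of_nonneg_of_pos (hv i) (by positivity)⟩
  have hmono : StrictMono fun k : Fin d => v (s k) + ε * ((k : ℕ) + 1) := by
    intro k l hkl
    have h1 : v (s k) ≤ v (s l) := Tuple.monotone_sort v hkl.le
    have h2 : ((k : ℕ) : ℝ) < ((l : ℕ) : ℝ) := by exact_mod_cast hkl
    have h3 := mul_lt_mul_of_pos_left h2 hε
    show v (s k) + ε * ((k : ℕ) + 1) < v (s l) + ε * ((l : ℕ) + 1)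
    linarith
  have := hmono.injective.comp s.symm.injective
  convert this using 2 with i
  simp

theorem tendsto_subentropyExpr {d : ℕ} {v : Fin d → ℝ} (hv : ∀ i, 0 ≤ v i) :
    Filter.Tendsto subentropyExpr (𝓝[{μ | Function.Injective μ ∧ ∀ i, 0 < μ i}] v)
      (𝓝 (∫ t in Set.Ioi (0 : ℝ), subentropyIntegrand v t)) := by
  refine (tendsto_integral_subentropyIntegrand hv).congr' ?_
  filter_upwards [self_mem_nhdsWithin] with μ hμ
  exact (subentropyExpr_eq_integral hμ.1 hμ.2).symm

theorem limUnder_subentropyExpr {d : ℕ} {v : Fin d → ℝ} (hv : ∀ i, 0 ≤ v i) :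
    Filter.limUnder (𝓝[{μ | Function.Injective μ ∧ ∀ i, 0 < μ i}] v) subentropyExpr =
      ∫ t in Set.Ioi (0 : ℝ), subentropyIntegrand v t :=
  haveI := neBot_nhdsWithin_injective_pos hv
  (tendsto_subentropyExpr hv).limUnder_eq

theorem tendsto_subentropy {d : ℕ} {ρ : Matrix (Fin d) (Fin d) ℂ} (hρ : ρ ∈ densityMatrices d) :
    (genericNhds ρ).NeBot ∧
      Filter.Tendsto subentropyExpr (genericNhds ρ) (𝓝 (subentropy ρ)) := by
  have h0 := (spectrumVec_mem_stdSimplex hρ).1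
  refine ⟨neBot_nhdsWithin_injective_pos h0, ?_⟩
  rw [subentropy, genericNhds, limUnder_subentropyExpr h0]
  exact tendsto_subentropyExpr h0

/-! ### Concavity and symmetry of the subentropy -/

theorem prod_div_add_convex {d : ℕ} {v w : Fin d → ℝ} (hv : ∀ i, 0 ≤ v i) (hw : ∀ i, 0 ≤ w i)
    {a b t : ℝ} (ha : 0 ≤ a) (hb : 0 ≤ b) (hab : a + b = 1) (ht : 0 < t) :
    ∏ i, t / (t + (a • v + b • w) i) ≤ a * ∏ i, t / (t + v i) + b * ∏ i, t / (t + w i) := by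
  -- The product is log-convex, being the exponential of a sum of convex functions `log t - log (t +
  -- u i)`; hence it is convex.
  have e : ∀ u : Fin d → ℝ, (∀ i, 0 ≤ u i) →
      ∏ i, t / (t + u i) = Real.exp (∑ i, (Real.log t - Real.log (t + u i))) := by
    intro u hu
    rw [Real.exp_sum]
    refine Finset.prod_congr rfl fun i _ => ?_
    rw [Real.exp_sub, Real.exp_log ht, Real.exp_log (add_pos_of_pos_of_nonneg ht (hu i))]
  rw [e v hv, e w hw, e (a • v + b • w) fun i =>
    add_nonneg (mul_nonneg ha (hv i)) (mul_nonneg hb (hw i))]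
  refine le_trans ?_ (convexOn_exp.2 (Set.mem_univ _) (Set.mem_univ _) ha hb hab)
  rw [Real.exp_le_exp]
  simp only [smul_eq_mul, Finset.mul_sum, ← Finset.sum_add_distrib]
  refine Finset.sum_le_sum fun i _ => ?_
  have h := strictConcaveOn_log_Ioi.concaveOn.2
    (show t + v i ∈ Set.Ioi 0 from add_pos_of_pos_of_nonneg ht (hv i))
    (show t + w i ∈ Set.Ioi 0 from add_pos_of_pos_of_nonneg ht (hw i)) ha hb hab
  simp only [smul_eq_mul] at h
  have e' : a * (t + v i) + b * (t + w i) = t + (a • v + b • w) i := by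
    simp only [Pi.add_apply, Pi.smul_apply, smul_eq_mul]
    linear_combination t * hab
  rw [e'] at h
  have e'' : Real.log t = a * Real.log t + b * Real.log t := by rw [← add_mul, hab, one_mul]
  linarith

theorem concaveOn_integral_subentropyIntegrand (d : ℕ) :
    ConcaveOn ℝ (stdSimplex ℝ (Fin d))
      fun v => ∫ t in Set.Ioi (0 : ℝ), subentropyIntegrand v t := by
  refine ⟨convex_stdSimplex ℝ (Fin d), ?_⟩
  intro v hv w hw a b ha hb hab
  have iv := integrableOn_subentropyIntegrand hv.1
  have iw := integrableOn_subentropyIntegrand hw.1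
  have iu := integrableOn_subentropyIntegrand (convex_stdSimplex ℝ (Fin d) hv hw ha hb hab).1
  simp only [smul_eq_mul]
  rw [← integral_const_mul, ← integral_const_mul, ← integral_add (iv.const_mul a) (iw.const_mul b)]
  refine setIntegral_mono_on ((iv.const_mul a).add (iw.const_mul b)) iu measurableSet_Ioi ?_
  intro t ht
  have h := prod_div_add_convex hv.1 hw.1 ha hb hab ht
  have hu := (convex_stdSimplex ℝ (Fin d) hv hw ha hb hab).2
  simp only [subentropyIntegrand]
  rw [hv.2, hw.2, hu]
  have e : (1 : ℝ) - 1 / (1 + t) = a * (1 - 1 / (1 + t)) + b * (1 - 1 / (1 + t)) := by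
    rw [← add_mul, hab, one_mul]
  linarith

theorem subentropyExpr_comp_perm {d : ℕ} (π : Equiv.Perm (Fin d)) (μ : Fin d → ℝ) :
    subentropyExpr (μ ∘ π) = subentropyExpr μ := by
  unfold subentropyExpr
  rw [← Equiv.sum_comp π fun i =>
    μ i ^ d / (∏ j ∈ Finset.univ.erase i, (μ i - μ j)) * Real.log (μ i)]
  congr 1
  refine Finset.sum_congr rfl fun i _ => ?_
  have : ∏ j ∈ Finset.univ.erase i, (μ (π i) - μ (π j)) =
      ∏ j ∈ Finset.univ.erase (π i), (μ (π i) - μ j) := by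
    refine Finset.prod_equiv π (fun j => ?_) (fun j _ => rfl)
    simp
  simp only [Function.comp_apply, this]

/-- Symmetry is required at every real vector, including those where no limit is known to exist.
Permuting coordinates is a homeomorphism that carries one filter to the other, so the two `limUnder`
values agree regardless of convergence. -/
theorem limUnder_subentropyExpr_comp_perm {d : ℕ} (π : Equiv.Perm (Fin d)) (v : Fin d → ℝ) :
    Filter.limUnder (𝓝[{μ | Function.Injective μ ∧ ∀ i, 0 < μ i}] (v ∘ π)) subentropyExpr =
      Filter.limUnder (𝓝[{μ | Function.Injective μ ∧ ∀ i, 0 < μ i}] v) subentropyExpr := by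
  let h : (Fin d → ℝ) ≃ₜ (Fin d → ℝ) := Homeomorph.piCongrLeft (Y := fun _ => ℝ) π.symm
  have hh : ∀ μ : Fin d → ℝ, h μ = μ ∘ π := by
    intro μ
    ext i
    have := Equiv.piCongrLeft_apply_apply (fun _ => ℝ) π.symm μ (π i)
    rwa [Equiv.symm_apply_apply] at this
  have hmap : Filter.map h (𝓝[{μ | Function.Injective μ ∧ ∀ i, 0 < μ i}] v) =
      𝓝[{μ | Function.Injective μ ∧ ∀ i, 0 < μ i}] (v ∘ π) := by
    rw [h.isEmbedding.map_nhdsWithin_eq, hh]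
    congr 1
    rw [h.image_eq_preimage_symm]
    ext μ
    obtain ⟨ν, rfl⟩ := h.surjective μ
    rw [Set.mem_preimage, Homeomorph.symm_apply_apply, hh]
    refine and_congr ?_ ?_
    · exact (π.injective_comp ν).symm
    · exact (π.forall_congr_right (q := fun i => 0 < ν i)).symm
  rw [Filter.limUnder, Filter.limUnder, ← hmap, Filter.map_map]
  congr 2
  ext μ
  rw [Function.comp_apply, hh, subentropyExpr_comp_perm]

theorem subentropy_mem_classF (d : ℕ) : subentropy ∈ classF d := by
  refine comp_spectrumVec_mem_classF (φ := fun v => Filter.limUnder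
    (𝓝[{μ | Function.Injective μ ∧ ∀ i, 0 < μ i}] v) subentropyExpr) ?_
    limUnder_subentropyExpr_comp_perm
  exact (concaveOn_integral_subentropyIntegrand d).congr fun v hv =>
    (limUnder_subentropyExpr hv.1).symm

end QuditEPI

theorem theorem1 (d : ℕ) :
    -- the entropy power inequality for the whole class
    (∀ f ∈ QuditEPI.classF d, ∀ ρ ∈ QuditEPI.densityMatrices d,
      ∀ σ ∈ QuditEPI.densityMatrices d, ∀ a ∈ Set.Icc (0 : ℝ) 1,
        QuditEPI.boxplus a ρ σ ∈ QuditEPI.densityMatrices d ∧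
        f (QuditEPI.boxplus a ρ σ) ≥ a * f ρ + (1 - a) * f σ) ∧
    -- members of the class
    QuditEPI.vonNeumannEntropy ∈ QuditEPI.classF d ∧
    (∀ α ∈ Set.Ico (0 : ℝ) 1, QuditEPI.renyiEntropy α ∈ QuditEPI.classF d) ∧
    -- the limit that defines the subentropy exists
    (∀ ρ ∈ QuditEPI.densityMatrices d, (QuditEPI.genericNhds ρ).NeBot ∧
      Filter.Tendsto QuditEPI.subentropyExpr (QuditEPI.genericNhds ρ)
        (nhds (QuditEPI.subentropy ρ))) ∧
    QuditEPI.subentropy ∈ QuditEPI.classF d := by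
  exact ⟨fun _ hf _ hρ _ hσ _ ha =>
      ⟨QuditEPI.boxplus_mem_densityMatrices hρ hσ ha, QuditEPI.le_boxplus hf hρ hσ ha⟩,
    QuditEPI.vonNeumannEntropy_mem_classF d,
    fun _ hα => QuditEPI.renyiEntropy_mem_classF d hα,
    fun _ hρ => QuditEPI.tendsto_subentropy hρ,
    QuditEPI.subentropy_mem_classF d⟩
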